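/- For integers $n_1,n_2,m\ge 0$ put $$A(n_1,n_2,m)=\frac{(2m+n_1+n_2+1)(2m+n_1+n_2)}{2}+m(n_1+n_2)+(n_1+n_2)^2-n_1 .$$ With $(b;b)_n=\prod_{i=1}^{n}(1-b^i)$ and $a,k\in\mathbb Z$, let ${a\brack k}_b=\frac{(b;b)_a}{(b;b)_{a-k}(b;b)_k}$ if $0\le k\le a$ and ${a\brack k}_b=0$ otherwise. For an integer $N\ge 0$ consider $$\sum_{n_1,n_2,m\ge 0}x^{n_1+n_2+m}q^{A(n_1,n_2,m)}{N-3(n_1+n_2+m)+1\brack m}_q{\left\lfloor\frac{N-[3(n_1-1)+1]}{3}\right\rfloor-m-n_2+\left\lfloor\frac{n_1}{2}\right\rfloor\brack\left\lfloor\frac{n_1}{2}\right\rfloor}_{q^6}{\left\lfloor\frac{N-[3(n_1+n_2-1)+2]}{3}\right\rfloor-m+\left\lfloor\frac{n_2}{2}\right\rfloor\brack\left\lfloor\frac{n_2}{2}\right\rfloor}_{q^6},$$ where the first $q$-binomial factor is omitted (replaced by $1$) if $m=0$, the second if $n_1=0$, and the third if $n_2=0$. Only finitely many summands are nonzero, and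 for all $k,n\ge 0$ the coefficient of $x^kq^n$ in the sum is the number of partitions of $n$ into exactly $k$ parts, all of them $\le N$, in which consecutive parts differ by at least $3$, and by at least $6$ if both are multiples of $3$. If $N\not\equiv 1\pmod 3$, the same holds when no factor is omitted. -/

import Mathlib

noncomputable section

namespace SchurGF

/-- The finite `q`-Pochhammer symbol `(a; b)_n = (1 - a)(1 - a b) ⋯ (1 - a b^(n-1))`,
for formal power series `a`, `b` in the variable `q = PowerSeries.X`. -/
def qPoch (a b : PowerSeries ℚ) (n : ℕ) : PowerSeries ℚ :=
  ∏ i ∈ Finset.range n, (1 - a * b ^ i)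

/-- The `q`-binomial coefficient with integer arguments `top`, `bot` and base `b`:
`(b; b)_top / ((b; b)_(top - bot) (b; b)_bot)` if `0 ≤ bot ≤ top`, and `0` otherwise.
For `b = q ^ k` with `k ≥ 1` the denominator has constant coefficient `1`, so that `⁻¹` is a
genuine inverse. -/
def qBinom (b : PowerSeries ℚ) (top bot : ℤ) : PowerSeries ℚ :=
  if 0 ≤ bot ∧ bot ≤ top then
    qPoch b b top.toNat * (qPoch b b (top - bot).toNat * qPoch b b bot.toNat)⁻¹
  else 0

/-- The exponent `A(n₁, n₂, m)`. The division by `2` is exact and the subtraction does not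
truncate, see `weight_cast`. -/
def weight (n₁ n₂ m : ℕ) : ℕ :=
  (2 * m + n₁ + n₂ + 1) * (2 * m + n₁ + n₂) / 2 + m * (n₁ + n₂) + (n₁ + n₂) ^ 2 - n₁

theorem weight_cast (n₁ n₂ m : ℕ) :
    (weight n₁ n₂ m : ℚ) =
      ((2 * m + n₁ + n₂ + 1) * (2 * m + n₁ + n₂) : ℚ) / 2 + m * (n₁ + n₂) + (n₁ + n₂) ^ 2 - n₁ := by
  have h2 : 2 ∣ (2 * m + n₁ + n₂ + 1) * (2 * m + n₁ + n₂) := by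
    rw [mul_comm]
    exact (Nat.even_mul_succ_self _).two_dvd
  have h1 : n₁ ≤ (2 * m + n₁ + n₂ + 1) * (2 * m + n₁ + n₂) / 2 + m * (n₁ + n₂)
      + (n₁ + n₂) ^ 2 := by
    nlinarith [Nat.zero_le ((2 * m + n₁ + n₂ + 1) * (2 * m + n₁ + n₂) / 2 + m * (n₁ + n₂)),
      Nat.le_self_pow (two_ne_zero) (n₁ + n₂)]
  unfold weight
  rw [Nat.cast_sub h1, Nat.cast_add, Nat.cast_add, Nat.cast_div h2 (by norm_num)]
  push_cast
  ring

/-- The factor `[N - 3(n₁ + n₂ + m) + 1, m]_q`. -/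
def factorM (N n₁ n₂ m : ℕ) : PowerSeries ℚ :=
  qBinom PowerSeries.X ((N : ℤ) - 3 * (n₁ + n₂ + m) + 1) m

/-- The factor `[⌊(N - [3(n₁ - 1) + 1]) / 3⌋ - m - n₂ + ⌊n₁ / 2⌋, ⌊n₁ / 2⌋]_{q^6}`.
Division of integers by a positive integer rounds down. -/
def factorOne (N n₁ n₂ m : ℕ) : PowerSeries ℚ :=
  qBinom (PowerSeries.X ^ 6)
    (((N : ℤ) - (3 * ((n₁ : ℤ) - 1) + 1)) / 3 - m - n₂ + (n₁ : ℤ) / 2) ((n₁ : ℤ) / 2)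

/-- The factor `[⌊(N - [3(n₁ + n₂ - 1) + 2]) / 3⌋ - m + ⌊n₂ / 2⌋, ⌊n₂ / 2⌋]_{q^6}`. -/
def factorTwo (N n₁ n₂ m : ℕ) : PowerSeries ℚ :=
  qBinom (PowerSeries.X ^ 6)
    (((N : ℤ) - (3 * ((n₁ : ℤ) + n₂ - 1) + 2)) / 3 - m + (n₂ : ℤ) / 2) ((n₂ : ℤ) / 2)

/-- The summand `x^(n₁+n₂+m) q^A(n₁,n₂,m)` times the three factors as displayed, a polynomial in
`x` whose coefficients are power series in `q`. -/
def rawSummand (N : ℕ) (t : ℕ × ℕ × ℕ) : Polynomial (PowerSeries ℚ) :=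
  Polynomial.monomial (t.1 + t.2.1 + t.2.2)
    (PowerSeries.X ^ weight t.1 t.2.1 t.2.2 * factorM N t.1 t.2.1 t.2.2 *
      factorOne N t.1 t.2.1 t.2.2 * factorTwo N t.1 t.2.1 t.2.2)

/-- The summand in which the factor that belongs to an index equal to `0` is left out. -/
def summand (N : ℕ) (t : ℕ × ℕ × ℕ) : Polynomial (PowerSeries ℚ) :=
  Polynomial.monomial (t.1 + t.2.1 + t.2.2)
    (PowerSeries.X ^ weight t.1 t.2.1 t.2.2 *
      (if t.2.2 = 0 then 1 else factorM N t.1 t.2.1 t.2.2) *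
      (if t.1 = 0 then 1 else factorOne N t.1 t.2.1 t.2.2) *
      (if t.2.1 = 0 then 1 else factorTwo N t.1 t.2.1 t.2.2))

/-- Schur's gap conditions: with the parts in decreasing order, consecutive parts differ by at
least `3`, and by at least `6` if both are multiples of `3`. -/
def SchurGap {n : ℕ} (p : n.Partition) : Prop :=
  (p.parts.sort (· ≥ ·)).IsChain (fun a b => b + 3 ≤ a ∧ (3 ∣ a → 3 ∣ b → b + 6 ≤ a))

/-- The number of partitions of `n` into exactly `k` parts that satisfy Schur's gap conditions and
have all parts `≤ N`. -/
def schurCount (N k n : ℕ) : ℕ :=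
  Nat.card {p : n.Partition // SchurGap p ∧ (∀ a ∈ p.parts, a ≤ N) ∧ p.parts.card = k}

/-- `F` is the generating function of these partitions: the coefficient of `x^k q^n` in `F` is
their number. -/
def IsSchurGF (N : ℕ) (F : Polynomial (PowerSeries ℚ)) : Prop :=
  ∀ k n : ℕ, PowerSeries.coeff n (F.coeff k) = (schurCount N k n : ℚ)

end SchurGF

end

namespace SchurGF

open Finset

/-! ### The `q`-binomial coefficient -/

/-! Let S(N,k) be the series for `k` parts at most `N`. Splitting off a largest part gives
S(N+1,k+1) = S(N,k+1) + q^(N+1) S(`nextBound (N+1)`,k) (`schurSeries_succ`). Put N+3 = 3k+i and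
divide by q^(1+4+⋯+(3k-2)), the weight of the tightest chain. The recurrence then depends on `N`
only through `i`. It is solved by the w^k coefficients of products G_i (`gapGF i`) with G_0 = 1,
where G_(i+1) is G_i (1+wq^i) if i ≡ 2 mod 3 and G_i/(1-wq^i) otherwise
(`schurSeries_eq_coeff_gapGF`). For i ≥ 2 write 1/(1-wq^i) = (1+wq^i)/(1-w²q^(2i)). All numerators
merge into (-wq²;q)_(i-2), and the denominators form one product in base q^6 for i ≡ 0 and its image
under w ↦ wq for i ≡ 1. Expanding these three series with indices m, n₁, n₂ gives the triple sum
(`summandCoeff_eq`). -/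

theorem qPoch_succ (b : PowerSeries ℚ) (n : ℕ) :
    qPoch b b (n + 1) = qPoch b b n * (1 - b ^ (n + 1)) := by
  simp [qPoch, Finset.prod_range_succ, pow_succ']

theorem constantCoeff_qPoch {b : PowerSeries ℚ} (hb : PowerSeries.constantCoeff b = 0) (n : ℕ) :
    PowerSeries.constantCoeff (qPoch b b n) = 1 := by
  simp [qPoch, map_prod, hb]

theorem qPoch_ne_zero {b : PowerSeries ℚ} (hb : PowerSeries.constantCoeff b = 0) (n : ℕ) :
    qPoch b b n ≠ 0 := by
  intro h
  have := constantCoeff_qPoch hb n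
  simp [h] at this

theorem qBinom_eq_zero {b : PowerSeries ℚ} {t k : ℤ} (h : t < k) : qBinom b t k = 0 := by
  rw [qBinom, if_neg (by omega)]

theorem qBinom_mul {b : PowerSeries ℚ} (hb : PowerSeries.constantCoeff b = 0) (l k : ℕ) :
    qBinom b ((l + k : ℕ) : ℤ) k * (qPoch b b l * qPoch b b k) = qPoch b b (l + k) := by
  have h : ((l + k : ℕ) : ℤ) - k = (l : ℤ) := by push_cast; ring
  rw [qBinom, if_pos (by omega), h]
  simp only [Int.toNat_natCast]
  rw [mul_assoc, PowerSeries.inv_mul_cancel, mul_one]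
  simp [constantCoeff_qPoch hb]

theorem qBinom_zero_right {b : PowerSeries ℚ} (hb : PowerSeries.constantCoeff b = 0) {t : ℤ}
    (ht : 0 ≤ t) : qBinom b t 0 = 1 := by
  obtain ⟨l, rfl⟩ := Int.eq_ofNat_of_zero_le ht
  have h := qBinom_mul hb l 0
  have h0 : qPoch b b 0 = 1 := by simp [qPoch]
  rw [h0, mul_one] at h
  exact mul_right_cancel₀ (qPoch_ne_zero hb l) (by simpa using h)

theorem qBinom_self {b : PowerSeries ℚ} (hb : PowerSeries.constantCoeff b = 0) (k : ℕ) :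
    qBinom b k k = 1 := by
  have h := qBinom_mul hb 0 k
  have h0 : qPoch b b 0 = 1 := by simp [qPoch]
  rw [h0, one_mul] at h
  exact mul_right_cancel₀ (qPoch_ne_zero hb k) (by simpa using h)

/-- The `q`-Pascal rule. -/
theorem qBinom_succ_succ {b : PowerSeries ℚ} (hb : PowerSeries.constantCoeff b = 0) (l k : ℕ) :
    qBinom b ((l + k + 1 : ℕ) : ℤ) ((k + 1 : ℕ) : ℤ) =
      qBinom b ((l + k : ℕ) : ℤ) ((k + 1 : ℕ) : ℤ) + b ^ l * qBinom b ((l + k : ℕ) : ℤ) k := by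
  rcases l with _ | l
  -- Here the first term on the right lies outside the range of `qBinom_mul`.
  · have h1 : qBinom b ((0 + k : ℕ) : ℤ) ((k + 1 : ℕ) : ℤ) = 0 := qBinom_eq_zero (by omega)
    have h2 : 0 + k + 1 = k + 1 := by omega
    have h3 : 0 + k = k := by omega
    rw [h1, h2, h3, qBinom_self hb, qBinom_self hb]
    simp
  · have h1 := qBinom_mul hb (l + 1) (k + 1)
    have h2 := qBinom_mul hb l (k + 1)
    have h3 := qBinom_mul hb (l + 1) k
    have e1 : l + 1 + (k + 1) = l + 1 + k + 1 := by omega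
    have e2 : l + (k + 1) = l + 1 + k := by omega
    rw [e1, qPoch_succ b (l + 1 + k)] at h1
    rw [e2] at h2
    -- With denominators cleared, what remains is 1 - b^(l+k+2) = (1 - b^(l+1)) + b^(l+1) (1 -
    -- b^(k+1)).
    apply mul_right_cancel₀ (mul_ne_zero (qPoch_ne_zero hb (l + 1)) (qPoch_ne_zero hb (k + 1)))
    rw [h1, add_mul]
    have h4 : qBinom b ((l + 1 + k : ℕ) : ℤ) ((k + 1 : ℕ) : ℤ) *
        (qPoch b b (l + 1) * qPoch b b (k + 1)) = qPoch b b (l + 1 + k) * (1 - b ^ (l + 1)) := by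
      rw [← h2, qPoch_succ b l]; ring
    have h5 : qBinom b ((l + 1 + k : ℕ) : ℤ) k *
        (qPoch b b (l + 1) * qPoch b b (k + 1)) = qPoch b b (l + 1 + k) * (1 - b ^ (k + 1)) := by
      rw [← h3, qPoch_succ b k]; ring
    rw [h4, mul_assoc, h5]
    ring

/-! ### Generating functions in the second variable -/

/-- `∑_m q^(m(m+3)/2) [J, m]_q w^m`, which is `(-w q²; q)_J`. -/
noncomputable def distinctGF (J : ℕ) : PowerSeries (PowerSeries ℚ) :=
  PowerSeries.mk fun m =>
    PowerSeries.X ^ (∑ j ∈ range m, (j + 2)) * qBinom PowerSeries.X J m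

theorem distinctGF_zero : distinctGF 0 = 1 := by
  ext1 m
  rcases m with _ | m
  · simp [distinctGF, qBinom_zero_right]
  · rw [distinctGF, PowerSeries.coeff_mk, qBinom_eq_zero (by omega), PowerSeries.coeff_one]
    simp

theorem distinctGF_succ (J : ℕ) :
    distinctGF (J + 1) =
      distinctGF J * (1 + PowerSeries.X * PowerSeries.C (PowerSeries.X ^ (J + 2))) := by
  ext1 m
  rw [mul_add, mul_one, ← mul_assoc, map_add, PowerSeries.coeff_mul_C]
  rcases m with _ | m
  · rw [PowerSeries.coeff_zero_mul_X]
    simp [distinctGF, qBinom_zero_right, add_nonneg]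
  · rw [PowerSeries.coeff_succ_mul_X]
    simp only [distinctGF, PowerSeries.coeff_mk]
    rcases le_or_gt m J with h | h
    · obtain ⟨l, rfl⟩ := Nat.exists_eq_add_of_le' h
      rw [qBinom_succ_succ (by simp), Finset.sum_range_succ]
      ring
    · rw [qBinom_eq_zero (by omega), qBinom_eq_zero (by omega), qBinom_eq_zero (by omega)]
      simp

/-- `∑_n [t - 1 + ⌊n/2⌋, ⌊n/2⌋]_{q^6} w^n`, the constant term being `1`. -/
noncomputable def pairGF (t : ℕ) : PowerSeries (PowerSeries ℚ) :=
  PowerSeries.mk fun n =>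
    if n = 0 then 1 else qBinom (PowerSeries.X ^ 6) ((t : ℤ) - 1 + (n : ℤ) / 2) ((n : ℤ) / 2)

theorem pairGF_zero : pairGF 0 = 1 := by
  ext1 n
  rw [pairGF, PowerSeries.coeff_mk, PowerSeries.coeff_one]
  split_ifs
  · rfl
  · exact qBinom_eq_zero (by omega)

theorem coeff_pairGF_succ (t n : ℕ) :
    PowerSeries.coeff n (pairGF (t + 1)) =
      qBinom (PowerSeries.X ^ 6) ((t + n / 2 : ℕ) : ℤ) ((n / 2 : ℕ) : ℤ) := by
  rw [pairGF, PowerSeries.coeff_mk]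
  split_ifs with h
  · subst h
    rw [Nat.zero_div, Nat.cast_zero, qBinom_zero_right (by simp) (by omega)]
  · congr 1
    push_cast
    ring

theorem pairGF_one : pairGF 1 * (1 - PowerSeries.X) = 1 := by
  ext1 n
  rw [mul_sub, mul_one, map_sub]
  have h (n : ℕ) : PowerSeries.coeff n (pairGF 1) = 1 := by
    rw [← zero_add 1, coeff_pairGF_succ, zero_add, qBinom_self (by simp)]
  rcases n with _ | n
  · rw [PowerSeries.coeff_zero_mul_X, h]
    simp
  · rw [PowerSeries.coeff_succ_mul_X, h, h, PowerSeries.coeff_one]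
    simp

/-- Coefficients depend only on ⌊n/2⌋, so lowering n by 2 is one step of the Pascal rule in base
q^6. Hence `pairGF t` is (1+w)/(w²;q^6)_t for t ≥ 1. -/
theorem pairGF_succ_succ (t : ℕ) :
    pairGF (t + 2) *
      (1 - PowerSeries.X ^ 2 * PowerSeries.C (PowerSeries.X ^ (6 * (t + 1)))) = pairGF (t + 1) := by
  ext1 n
  rw [mul_sub, mul_one, ← mul_assoc, map_sub, PowerSeries.coeff_mul_C,
    PowerSeries.coeff_mul_X_pow']
  rcases lt_or_ge n 2 with h | h
  · have h2 : n / 2 = 0 := by omega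
    rw [if_neg (by omega), coeff_pairGF_succ, coeff_pairGF_succ, h2, Nat.cast_zero,
      qBinom_zero_right (by simp) (by omega), qBinom_zero_right (by simp) (by omega)]
    simp
  · obtain ⟨n, rfl⟩ := Nat.exists_eq_add_of_le' h
    have h2 : (n + 2) / 2 = n / 2 + 1 := by omega
    have e1 : t + 1 + (n / 2 + 1) = t + 1 + n / 2 + 1 := by omega
    have e2 : t + (n / 2 + 1) = t + 1 + n / 2 := by omega
    rw [if_pos h, Nat.add_sub_cancel, coeff_pairGF_succ, coeff_pairGF_succ, coeff_pairGF_succ,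
      h2, e1, e2, qBinom_succ_succ (by simp)]
    ring

theorem rescale_C (a c : PowerSeries ℚ) :
    PowerSeries.rescale a (PowerSeries.C c) = PowerSeries.C c := by
  ext1 n
  rw [PowerSeries.coeff_rescale, PowerSeries.coeff_C]
  split_ifs with h <;> simp [h]

/-! ### The product and its one-step recurrence -/

/-- The product whose coefficient at `w^k` is, up to a power of `q`, the coefficient of `x^k` in
the generating function for parts at most `3 k + i - 3`. -/
noncomputable def gapGF (i : ℕ) : PowerSeries (PowerSeries ℚ) :=
  distinctGF (i - 2) * pairGF ((i + 2) / 3) *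
    PowerSeries.rescale PowerSeries.X (pairGF ((i + 1) / 3))

theorem gapGF_zero : gapGF 0 = 1 := by
  simp [gapGF, distinctGF_zero, pairGF_zero]

theorem coeff_zero_gapGF (i : ℕ) : PowerSeries.coeff 0 (gapGF i) = 1 := by
  have h : PowerSeries.constantCoeff
      (PowerSeries.rescale (PowerSeries.X : PowerSeries ℚ) (pairGF ((i + 1) / 3))) = 1 := by
    rw [← PowerSeries.coeff_zero_eq_constantCoeff_apply, PowerSeries.coeff_rescale]
    simp [pairGF]
  rw [PowerSeries.coeff_zero_eq_constantCoeff_apply, gapGF, map_mul, h]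
  simp [distinctGF, pairGF, qBinom_zero_right]

theorem gapGF_succ_of_dvd {i : ℕ} (hi : 3 ∣ i + 1) :
    gapGF (i + 1) = gapGF i * (1 + PowerSeries.X * PowerSeries.C (PowerSeries.X ^ i)) := by
  obtain ⟨j, hj⟩ : ∃ j, i = 3 * j + 2 := ⟨i / 3, by omega⟩
  subst hj
  have h1 : (3 * j + 2 + 1 + 2) / 3 = j + 1 := by omega
  have h2 : (3 * j + 2 + 1 + 1) / 3 = j + 1 := by omega
  have h4 : (3 * j + 2 + 1) / 3 = j + 1 := by omega
  have h5 : 3 * j + 2 + 1 - 2 = 3 * j + 1 := by omega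
  have h6 : 3 * j + 2 - 2 = 3 * j := by omega
  simp only [gapGF, h1, h2, h4, h5, h6, distinctGF_succ]
  ring

theorem gapGF_succ_mul {i : ℕ} (hi : ¬ 3 ∣ i + 1) :
    gapGF (i + 1) * (1 - PowerSeries.X * PowerSeries.C (PowerSeries.X ^ i)) = gapGF i := by
  have hr : i % 3 = 0 ∨ i % 3 = 1 := by omega
  rcases hr with hr | hr
  · obtain ⟨j, rfl⟩ : ∃ j, i = 3 * j := ⟨i / 3, by omega⟩
    have h1 : (3 * j + 1 + 2) / 3 = j + 1 := by omega
    have h2 : (3 * j + 1 + 1) / 3 = j := by omega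
    have h4 : (3 * j + 1) / 3 = j := by omega
    simp only [gapGF, h1, h2, h4]
    rcases j with _ | j
    -- For i = 0 the numerators have not started yet (they begin at exponent 2), so the factor is
    -- 1/(1-w) itself.
    · have := pairGF_one
      simp [distinctGF_zero, pairGF_zero, this]
    · have h5 : 3 * (j + 1) + 1 - 2 = 3 * j + 1 + 1 := by omega
      have h6 : 3 * (j + 1) - 2 = 3 * j + 1 := by omega
      have h := pairGF_succ_succ j
      rw [h5, h6, distinctGF_succ]
      simp only [map_pow] at h ⊢
      -- The new numerator 1+wq^i times 1-wq^i is 1-w²q^(2i), the new denominator of the base q^6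
      -- product.
      linear_combination distinctGF (3 * j + 1) *
        PowerSeries.rescale PowerSeries.X (pairGF (j + 1)) * h
  · obtain ⟨j, rfl⟩ : ∃ j, i = 3 * j + 1 := ⟨i / 3, by omega⟩
    have h1 : (3 * j + 1 + 1 + 2) / 3 = j + 1 := by omega
    have h2 : (3 * j + 1 + 1 + 1) / 3 = j + 1 := by omega
    have h4 : (3 * j + 1 + 1) / 3 = j := by omega
    simp only [gapGF, h1, h2, h4]
    rcases j with _ | j
    · have := congrArg (PowerSeries.rescale (PowerSeries.X : PowerSeries ℚ)) pairGF_one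
      rw [map_mul, map_sub, map_one, PowerSeries.rescale_X] at this
      simp only [Nat.mul_zero, zero_add, pow_one, pairGF_zero, map_one, mul_one]
      rw [mul_comm PowerSeries.X, mul_assoc, this, mul_one]
    · have h5 : 3 * (j + 1) + 1 + 1 - 2 = 3 * j + 2 + 1 := by omega
      have h6 : 3 * (j + 1) + 1 - 2 = 3 * j + 2 := by omega
      have h := congrArg (PowerSeries.rescale (PowerSeries.X : PowerSeries ℚ)) (pairGF_succ_succ j)
      rw [map_mul, map_sub, map_one, map_mul, map_pow, PowerSeries.rescale_X,
        rescale_C] at h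
      rw [h5, h6, distinctGF_succ]
      simp only [map_pow] at h ⊢
      linear_combination distinctGF (3 * j + 2) * pairGF (j + 1 + 1) * h

/-! ### Schur partitions as decreasing lists -/

/-- Schur's condition on a part `a` and the next smaller part `b`. -/
def GapRel (a b : ℕ) : Prop := b + 3 ≤ a ∧ (3 ∣ a → 3 ∣ b → b + 6 ≤ a)

/-- The decreasing lists of `k` positive parts `≤ N` with sum `n` and Schur's gaps. -/
def schurLists (N k n : ℕ) : Set (List ℕ) :=
  {l | l.IsChain GapRel ∧ (∀ a ∈ l, 0 < a ∧ a ≤ N) ∧ l.length = k ∧ l.sum = n}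

theorem pairwise_ge_of_isChain_gapRel {l : List ℕ} (h : l.IsChain GapRel) :
    l.Pairwise (· ≥ ·) :=
  List.isChain_iff_pairwise.1 (h.imp fun a b hab => by have := hab.1; show b ≤ a; omega)

theorem schurLists_eq_image (N k n : ℕ) :
    schurLists N k n = (fun p : n.Partition => p.parts.sort (· ≥ ·)) ''
      {p | SchurGap p ∧ (∀ a ∈ p.parts, a ≤ N) ∧ p.parts.card = k} := by
  ext l
  constructor
  · rintro ⟨h1, h2, h3, h4⟩
    have hs : (l : Multiset ℕ).sort (· ≥ ·) = l := by
      rw [Multiset.coe_sort]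
      exact List.mergeSort_eq_self _ (pairwise_ge_of_isChain_gapRel h1)
    refine ⟨⟨l, fun {i} hi => (h2 i hi).1, by simpa using h4⟩, ⟨?_, ?_, ?_⟩, hs⟩
    · show List.IsChain GapRel ((l : Multiset ℕ).sort (· ≥ ·))
      rwa [hs]
    · exact fun a ha => (h2 a ha).2
    · simpa using h3
  · rintro ⟨p, ⟨h1, h2, h3⟩, rfl⟩
    refine ⟨h1, fun a ha => ?_, ?_, ?_⟩
    · rw [Multiset.mem_sort] at ha
      exact ⟨p.parts_pos ha, h2 a ha⟩
    · simpa using h3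
    · show (p.parts.sort (· ≥ ·)).sum = n
      rw [← Multiset.sum_coe, Multiset.sort_eq, p.parts_sum]

theorem finite_schurLists (N k n : ℕ) : (schurLists N k n).Finite := by
  rw [schurLists_eq_image]
  exact (Set.toFinite _).image _

theorem ncard_schurLists (N k n : ℕ) : (schurLists N k n).ncard = schurCount N k n := by
  rw [schurLists_eq_image, Set.ncard_image_of_injective, schurCount, ← Nat.card_coe_set_eq]
  · rfl
  · intro p p' h
    have := congrArg (fun l : List ℕ => (l : Multiset ℕ)) h
    simp only [Multiset.sort_eq] at this
    exact Nat.Partition.ext this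

/-! ### Removing the largest part -/

/-- The bound on the remaining parts once the part `N` has been used. -/
def nextBound (N : ℕ) : ℕ := if 3 ∣ N then N - 4 else N - 3

/-- If 3 ∣ N, the stronger gap only rules out N-3, since N-4 and N-5 are not multiples of 3.
Positivity of `b` makes truncated subtraction harmless. -/
theorem gapRel_iff {N b : ℕ} (hb : 0 < b) : GapRel N b ↔ b ≤ nextBound N := by
  unfold GapRel nextBound
  split_ifs <;> omega

theorem le_of_mem_of_isChain_gapRel {a b : ℕ} {l : List ℕ} (h : (a :: l).IsChain GapRel)
    (hb : b ∈ l) : b ≤ a :=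
  List.rel_of_pairwise_cons (pairwise_ge_of_isChain_gapRel h) hb

theorem cons_mem_schurLists_iff {N k n : ℕ} {l : List ℕ} (hN : 0 < N) :
    N :: l ∈ schurLists N (k + 1) (n + N) ↔ l ∈ schurLists (nextBound N) k n := by
  have hle : nextBound N ≤ N := by unfold nextBound; split_ifs <;> omega
  constructor
  · rintro ⟨h1, h2, h3, h4⟩
    refine ⟨h1.tail, fun b hb => ⟨(h2 b (by simp [hb])).1, ?_⟩, by simpa using h3, ?_⟩
    · rcases l with _ | ⟨c, l⟩
      · simp at hb
      · rw [List.isChain_cons_cons] at h1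
        have hc := (gapRel_iff (h2 c (by simp)).1).1 h1.1
        rcases List.mem_cons.1 hb with rfl | hb
        · exact hc
        · exact (le_of_mem_of_isChain_gapRel h1.2 hb).trans hc
    · simp only [List.sum_cons] at h4
      omega
  · rintro ⟨h1, h2, h3, h4⟩
    refine ⟨List.isChain_cons.2 ⟨fun b hb => ?_, h1⟩, fun a ha => ?_, by simpa using h3, ?_⟩
    · have hb := h2 b (List.mem_of_mem_head? hb)
      exact (gapRel_iff hb.1).2 hb.2
    · rcases List.mem_cons.1 ha with rfl | ha
      · exact ⟨hN, le_rfl⟩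
      · exact ⟨(h2 a ha).1, (h2 a ha).2.trans hle⟩
    · simp only [List.sum_cons]
      omega

theorem schurLists_succ (N k n : ℕ) :
    schurLists (N + 1) (k + 1) n = schurLists N (k + 1) n ∪
      (if N + 1 ≤ n then List.cons (N + 1) '' schurLists (nextBound (N + 1)) k (n - (N + 1))
        else ∅) := by
  ext l
  constructor
  · intro hl
    obtain ⟨h1, h2, h3, h4⟩ := hl
    rcases l with _ | ⟨a, l⟩
    · simp at h3
    · have ha := h2 a (by simp)
      rcases (show a ≤ N ∨ a = N + 1 by omega) with h | rfl
      · refine Or.inl ⟨h1, fun b hb => ⟨(h2 b hb).1, ?_⟩, h3, h4⟩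
        rcases List.mem_cons.1 hb with rfl | hb
        · exact h
        · exact (le_of_mem_of_isChain_gapRel h1 hb).trans h
      · have hn : N + 1 ≤ n := by simp only [List.sum_cons] at h4; omega
        right
        rw [if_pos hn]
        refine ⟨l, (cons_mem_schurLists_iff (Nat.succ_pos N)).1 ?_, rfl⟩
        rw [Nat.sub_add_cancel hn]
        exact ⟨h1, h2, h3, h4⟩
  · rintro (⟨h1, h2, h3, h4⟩ | h)
    · exact ⟨h1, fun a ha => ⟨(h2 a ha).1, (h2 a ha).2.trans (Nat.le_succ N)⟩, h3, h4⟩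
    · split_ifs at h with hn
      · obtain ⟨l, hl, rfl⟩ := h
        have := (cons_mem_schurLists_iff (Nat.succ_pos N)).2 hl
        rwa [Nat.sub_add_cancel hn] at this
      · exact h.elim

theorem schurCount_succ (N k n : ℕ) :
    schurCount (N + 1) (k + 1) n = schurCount N (k + 1) n +
      if N + 1 ≤ n then schurCount (nextBound (N + 1)) k (n - (N + 1)) else 0 := by
  rw [← ncard_schurLists, schurLists_succ, ← ncard_schurLists]
  split_ifs with hn
  · rw [Set.ncard_union_eq _ (finite_schurLists ..) ((finite_schurLists ..).image _),
      Set.ncard_image_of_injective _ (List.cons_injective), ncard_schurLists (nextBound (N + 1))]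
    rw [Set.disjoint_left]
    rintro _ ⟨_, h2, _⟩ ⟨l, _, rfl⟩
    have := (h2 (N + 1) (by simp)).2
    omega
  · simp

/-! ### Solving the recurrence by the product -/

/-- The generating function of the partitions into `k` parts counted by `schurCount`. -/
noncomputable def schurSeries (N k : ℕ) : PowerSeries ℚ :=
  PowerSeries.mk fun n => (schurCount N k n : ℚ)

theorem schurSeries_zero_right (N : ℕ) : schurSeries N 0 = 1 := by
  ext n
  rw [schurSeries, PowerSeries.coeff_mk, ← ncard_schurLists, PowerSeries.coeff_one]
  have h : schurLists N 0 n = if n = 0 then {[]} else ∅ := by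
    ext l
    split_ifs with hn <;> simp only [schurLists, Set.mem_ofPred_eq, List.length_eq_zero_iff]
    · constructor
      · exact fun h => h.2.2.1
      · rintro rfl
        simp [hn]
    · constructor
      · rintro ⟨_, _, rfl, h⟩
        exact hn (by simpa using h.symm)
      · exact fun h => h.elim
  rw [h]
  split_ifs <;> simp

theorem schurSeries_zero_left (k : ℕ) : schurSeries 0 (k + 1) = 0 := by
  ext n
  rw [schurSeries, PowerSeries.coeff_mk, ← ncard_schurLists]
  have h : schurLists 0 (k + 1) n = ∅ := by
    rw [Set.eq_empty_iff_forall_notMem]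
    rintro (_ | ⟨a, l⟩) ⟨_, h2, h3, _⟩
    · simp at h3
    · have := h2 a (by simp)
      omega
  simp [h]

theorem schurSeries_succ (N k : ℕ) :
    schurSeries (N + 1) (k + 1) =
      schurSeries N (k + 1) + PowerSeries.X ^ (N + 1) * schurSeries (nextBound (N + 1)) k := by
  ext n
  rw [map_add, PowerSeries.coeff_X_pow_mul']
  simp only [schurSeries, PowerSeries.coeff_mk, schurCount_succ]
  split_ifs <;> simp

/-- Gaps of at least 3 force the largest of k+1 parts to be at least 3k+1. -/
theorem schurSeries_eq_zero {N k : ℕ} (h : N + 3 ≤ 3 * (k + 1)) : schurSeries N (k + 1) = 0 := by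
  induction N using Nat.strong_induction_on generalizing k with
  | _ N ih =>
    rcases N with _ | N
    · exact schurSeries_zero_left k
    · rcases k with _ | k
      · omega
      · rw [schurSeries_succ, ih N (by omega) (by omega),
          ih (nextBound (N + 1)) (by unfold nextBound; split_ifs <;> omega)
            (by unfold nextBound; split_ifs <;> omega)]
        simp

theorem coeff_gapGF_succ (i k : ℕ) :
    PowerSeries.coeff (k + 1) (gapGF (i + 1)) = PowerSeries.coeff (k + 1) (gapGF i) +
      PowerSeries.X ^ i *
        PowerSeries.coeff k (gapGF (if 3 ∣ i + 1 then i else i + 1)) := by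
  split_ifs with h
  · rw [gapGF_succ_of_dvd h, mul_add, mul_one, ← mul_assoc, map_add, PowerSeries.coeff_mul_C,
      PowerSeries.coeff_succ_mul_X, mul_comm (PowerSeries.X ^ i)]
  · rw [← gapGF_succ_mul h, mul_sub, mul_one, ← mul_assoc, map_sub, PowerSeries.coeff_mul_C,
      PowerSeries.coeff_succ_mul_X, mul_comm (PowerSeries.X ^ i), sub_add_cancel]

theorem schurSeries_eq_coeff_gapGF (N k i : ℕ) (h : N + 3 = 3 * k + i) :
    schurSeries N k =
      PowerSeries.X ^ (∑ j ∈ range k, (3 * j + 1)) * PowerSeries.coeff k (gapGF i) := by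
  induction N using Nat.strong_induction_on generalizing k i with
  | _ N ih =>
    rcases k with _ | k
    · rw [schurSeries_zero_right, coeff_zero_gapGF]
      simp
    rcases i with _ | i
    · rw [schurSeries_eq_zero (by omega), gapGF_zero, PowerSeries.coeff_one]
      simp
    rcases N with _ | N
    · omega
    have e : (∑ j ∈ range (k + 1), (3 * j + 1)) + i = N + 1 + ∑ j ∈ range k, (3 * j + 1) := by
      rw [sum_range_succ]
      omega
    have h2 : schurSeries (nextBound (N + 1)) k =
        PowerSeries.X ^ (∑ j ∈ range k, (3 * j + 1)) *
          PowerSeries.coeff k (gapGF (if 3 ∣ i + 1 then i else i + 1)) := by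
      -- N + 1 and i + 1 agree mod 3, so both case distinctions match. The case k = 0 is separate
      -- because `nextBound` may truncate there.
      rcases k with _ | k
      · rw [schurSeries_zero_right, coeff_zero_gapGF]
        simp
      · rcases Nat.lt_or_ge N 3 with hN | hN
        · omega
        · apply ih _ (by unfold nextBound; split_ifs <;> omega)
          unfold nextBound
          split_ifs <;> omega
    rw [schurSeries_succ, ih N (by omega) (k + 1) i (by omega), h2, coeff_gapGF_succ, mul_add,
      ← mul_assoc, ← mul_assoc, ← pow_add, ← pow_add, e]

/-! ### The triple sum -/

/-- The three terms come from the tightest chain, the expansion of `distinctGF`, and the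
substitution w ↦ wq. -/
theorem weight_eq (n₁ n₂ m : ℕ) :
    weight n₁ n₂ m =
      (∑ j ∈ range (n₁ + n₂ + m), (3 * j + 1)) + (∑ j ∈ range m, (j + 2)) + n₂ := by
  have h1 (k : ℕ) : ((∑ j ∈ range k, (3 * j + 1) : ℕ) : ℚ) = k * (3 * k - 1) / 2 := by
    induction k with
    | zero => simp
    | succ k ih => rw [sum_range_succ, Nat.cast_add, ih]; push_cast; ring
  have h2 (k : ℕ) : ((∑ j ∈ range k, (j + 2) : ℕ) : ℚ) = k * (k + 3) / 2 := by
    induction k with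
    | zero => simp
    | succ k ih => rw [sum_range_succ, Nat.cast_add, ih]; push_cast; ring
  rw [← Nat.cast_inj (R := ℚ), weight_cast, Nat.cast_add, Nat.cast_add, h1, h2]
  push_cast
  ring

/-- The coefficient of the summand. -/
noncomputable def summandCoeff (N n₁ n₂ m : ℕ) : PowerSeries ℚ :=
  PowerSeries.X ^ weight n₁ n₂ m * (if m = 0 then 1 else factorM N n₁ n₂ m) *
    (if n₁ = 0 then 1 else factorOne N n₁ n₂ m) * (if n₂ = 0 then 1 else factorTwo N n₁ n₂ m)

theorem summandCoeff_eq_zero {N n₁ n₂ m : ℕ} (hN : N + 3 ≤ 3 * (n₁ + n₂ + m)) :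
    summandCoeff N n₁ n₂ m = 0 := by
  rw [summandCoeff]
  by_cases hm : m = 0
  · by_cases h1 : n₁ = 0
    · have h2 : n₂ ≠ 0 := by omega
      rw [if_neg h2, factorTwo, qBinom_eq_zero (by omega), mul_zero]
    · rw [if_neg h1, factorOne, qBinom_eq_zero (by omega), mul_zero, zero_mul]
  · rw [if_neg hm, factorM, qBinom_eq_zero (by omega), mul_zero, zero_mul, zero_mul]

theorem summandCoeff_eq {N n₁ n₂ m i : ℕ} (h : N + 3 = 3 * (n₁ + n₂ + m) + i) :
    summandCoeff N n₁ n₂ m =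
      PowerSeries.X ^ (∑ j ∈ range (n₁ + n₂ + m), (3 * j + 1)) *
        (PowerSeries.coeff m (distinctGF (i - 2)) *
          PowerSeries.coeff n₁ (pairGF ((i + 2) / 3)) *
          PowerSeries.coeff n₂ (PowerSeries.rescale PowerSeries.X (pairGF ((i + 1) / 3)))) := by
  have hM : PowerSeries.coeff m (distinctGF (i - 2)) =
      PowerSeries.X ^ (∑ j ∈ range m, (j + 2)) * if m = 0 then 1 else factorM N n₁ n₂ m := by
    rw [distinctGF, PowerSeries.coeff_mk]
    congr 1
    split_ifs with hm
    · rw [hm]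
      exact qBinom_zero_right (by simp) (by omega)
    -- The top entry of `factorM` is i-2. If it is negative, `distinctGF (i - 2)` truncates to 1,
    -- and both sides vanish as m > 0.
    · rcases Nat.lt_or_ge i 2 with hi | hi
      · rw [factorM, qBinom_eq_zero (by omega), qBinom_eq_zero (by omega)]
      · rw [factorM]
        congr 1
        omega
  have h1 : PowerSeries.coeff n₁ (pairGF ((i + 2) / 3)) =
      if n₁ = 0 then 1 else factorOne N n₁ n₂ m := by
    rw [pairGF, PowerSeries.coeff_mk, factorOne]
    congr 2
    omega
  have h2 : PowerSeries.coeff n₂ (pairGF ((i + 1) / 3)) =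
      if n₂ = 0 then 1 else factorTwo N n₁ n₂ m := by
    rw [pairGF, PowerSeries.coeff_mk, factorTwo]
    congr 2
    omega
  rw [PowerSeries.coeff_rescale, hM, h1, h2, summandCoeff, weight_eq, pow_add, pow_add]
  ring

/-- The triples `(n₁, n₂, m)` with sum `k`. -/
def triples (k : ℕ) : Finset (ℕ × ℕ × ℕ) :=
  (antidiagonal k).biUnion fun p => (antidiagonal p.1).image fun r => (r.2, p.2, r.1)

theorem mem_triples {k : ℕ} {t : ℕ × ℕ × ℕ} : t ∈ triples k ↔ t.1 + t.2.1 + t.2.2 = k := by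
  obtain ⟨a, b, c⟩ := t
  simp only [triples, mem_biUnion, mem_image, HasAntidiagonal.mem_antidiagonal, Prod.exists,
    Prod.mk.injEq]
  constructor
  · rintro ⟨x, y, hxy, u, v, huv, rfl, rfl, rfl⟩
    omega
  · intro h
    exact ⟨c + a, b, by omega, c, a, rfl, rfl, rfl, rfl⟩

/-- The nesting matches the coefficient of the threefold product in `gapGF`. -/
theorem sum_triples {M : Type*} [AddCommMonoid M] (k : ℕ) (f : ℕ × ℕ × ℕ → M) :
    ∑ t ∈ triples k, f t =
      ∑ p ∈ antidiagonal k, ∑ r ∈ antidiagonal p.1, f (r.2, p.2, r.1) := by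
  rw [triples, sum_biUnion]
  · refine sum_congr rfl fun p _ => sum_image ?_
    rintro ⟨a, b⟩ _ ⟨c, d⟩ _ h
    simp only [Prod.mk.injEq] at h ⊢
    tauto
  · intro p hp p' hp' hne
    rw [Function.onFun, Finset.disjoint_left]
    intro t ht ht'
    simp only [mem_image, HasAntidiagonal.mem_antidiagonal] at ht ht'
    obtain ⟨r, hr, rfl⟩ := ht
    obtain ⟨r', hr', h⟩ := ht'
    simp only [Prod.mk.injEq] at h
    apply hne
    ext <;> omega

theorem sum_summandCoeff (N k : ℕ) :
    ∑ t ∈ triples k, summandCoeff N t.1 t.2.1 t.2.2 = schurSeries N k := by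
  rcases Nat.lt_or_ge (N + 3) (3 * k) with h | h
  · obtain ⟨k, rfl⟩ : ∃ j, k = j + 1 := ⟨k - 1, by omega⟩
    rw [schurSeries_eq_zero h.le]
    refine sum_eq_zero fun t ht => summandCoeff_eq_zero ?_
    rw [mem_triples.1 ht]
    exact h.le
  · obtain ⟨i, hi⟩ := Nat.exists_eq_add_of_le h
    rw [schurSeries_eq_coeff_gapGF N k i hi, gapGF, PowerSeries.coeff_mul]
    simp only [PowerSeries.coeff_mul, sum_mul, mul_sum]
    rw [sum_triples]
    refine sum_congr rfl fun p hp => sum_congr rfl fun r hr => ?_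
    rw [HasAntidiagonal.mem_antidiagonal] at hp hr
    have hk : r.2 + p.2 + r.1 = k := by omega
    rw [summandCoeff_eq (i := i) (by rw [hk]; exact hi), hk]

theorem summand_eq (N : ℕ) (t : ℕ × ℕ × ℕ) :
    summand N t =
      Polynomial.monomial (t.1 + t.2.1 + t.2.2) (summandCoeff N t.1 t.2.1 t.2.2) :=
  rfl

theorem finite_support_summand (N : ℕ) : (Function.support (summand N)).Finite := by
  refine ((range (N + 3)).biUnion triples).finite_toSet.subset fun t ht => ?_
  rw [mem_coe, mem_biUnion]
  refine ⟨_, ?_, mem_triples.2 rfl⟩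
  by_contra h
  rw [mem_range] at h
  apply ht
  rw [summand_eq, summandCoeff_eq_zero (by omega), map_zero]

theorem isSchurGF_finsum_summand (N : ℕ) :
    IsSchurGF N (∑ᶠ t : ℕ × ℕ × ℕ, summand N t) := by
  intro k n
  have hf := finite_support_summand N
  have hs : Function.support (summand N) ⊆ ((hf.toFinset ∪ triples k : Finset _) : Set _) := by
    intro t ht
    rw [coe_union, hf.coe_toFinset]
    exact Or.inl ht
  have hc : (∑ᶠ t : ℕ × ℕ × ℕ, summand N t).coeff k = schurSeries N k := by
    rw [finsum_eq_sum_of_support_subset _ hs, Polynomial.finsetSum_coeff, ← sum_summandCoeff]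
    symm
    rw [← sum_subset (subset_union_right (s₁ := hf.toFinset) (s₂ := triples k))]
    · refine sum_congr rfl fun t ht => ?_
      rw [summand_eq, Polynomial.coeff_monomial, if_pos (mem_triples.1 ht)]
    · intro t _ ht
      rw [summand_eq, Polynomial.coeff_monomial, if_neg fun h => ht (mem_triples.2 h)]
  rw [hc, schurSeries, PowerSeries.coeff_mk]

/-- With N+3 = 3k+i, a factor of index 0 equals 1 once i ≥ 2. For i ≤ 0 some index is positive and
its factor vanishes in both versions. Only i = 1 could differ, and it forces N ≡ 1 mod 3. -/
theorem rawSummand_eq_summand {N : ℕ} (hN : N % 3 ≠ 1) : rawSummand N = summand N := by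
  funext t
  obtain ⟨n₁, n₂, m⟩ := t
  rw [summand_eq, rawSummand]
  congr 1
  simp only
  rcases Nat.lt_or_ge (N + 2) (3 * (n₁ + n₂ + m)) with h | h
  · rw [summandCoeff_eq_zero (by omega)]
    by_cases hm : m = 0 ∧ n₁ = 0
    · rw [factorTwo, qBinom_eq_zero (by omega), mul_zero]
    · by_cases hm : m = 0
      · rw [factorOne, qBinom_eq_zero (by omega), mul_zero, zero_mul]
      · rw [factorM, qBinom_eq_zero (by omega), mul_zero, zero_mul, zero_mul]
  · have hM : m = 0 → factorM N n₁ n₂ m = 1 := by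
      rintro rfl
      exact qBinom_zero_right (by simp) (by omega)
    have h1 : n₁ = 0 → factorOne N n₁ n₂ m = 1 := by
      rintro rfl
      exact qBinom_zero_right (by simp) (by omega)
    have h2 : n₂ = 0 → factorTwo N n₁ n₂ m = 1 := by
      rintro rfl
      exact qBinom_zero_right (by simp) (by omega)
    rw [summandCoeff]
    congr 1
    · congr 1
      · congr 1
        split_ifs with h
        exacts [hM h, rfl]
      · split_ifs with h
        exacts [h1 h, rfl]
    · split_ifs with h
      exacts [h2 h, rfl]

end SchurGF

theorem theorem4 (N : ℕ) :
    ((Function.support (SchurGF.summand N)).Finite ∧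
      SchurGF.IsSchurGF N (∑ᶠ t : ℕ × ℕ × ℕ, SchurGF.summand N t)) ∧
    (N % 3 ≠ 1 →
      (Function.support (SchurGF.rawSummand N)).Finite ∧
        SchurGF.IsSchurGF N (∑ᶠ t : ℕ × ℕ × ℕ, SchurGF.rawSummand N t)) := by
  have h := And.intro (SchurGF.finite_support_summand N) (SchurGF.isSchurGF_finsum_summand N)
  refine ⟨h, fun hN => ?_⟩
  rw [SchurGF.rawSummand_eq_summand hN]
  exact h
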